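/- Let $L,\alpha>0$ and $\Omega=[0,2\pi L]^3$. Let $\mathcal V$ be the set of real vector trigonometric polynomials $\phi:\mathbb R^3\to\mathbb R^3$ that are $2\pi L$-periodic in each variable, with $\nabla\cdot\phi=0$ and $\int_\Omega\phi\,dx=0$. Let $V$ be the closure of $\mathcal V$ in $H^1(\Omega)^3$, and let $V'$ be the dual space of $V$. For $u,w\in V$ regard $u$ as an element of $V'$ by $\langle u,w\rangle=\int_\Omega u\cdot w\,dx$. Let $A:V\to V'$ be the Stokes operator, $\langle Au,w\rangle=\int_\Omega\nabla u:\nabla w\,dx$, and let $B:V\times V\to V'$ be the bilinear operator $\langle B(u_1,u_2),w\rangle=\int_\Omega((u_1\cdot\nabla)u_2)\cdot w\,dx$. **Theorem (Global existence and uniqueness, inviscid simplified Bardina model).** Let $f\in V'$ (independent of time) and $v^{in}\in V'$. Then the system $$\frac{dv}{dt}+B(u,u)=f,\qquad v=u+\alpha^2Au,\qquad v(0)=v^{in},$$ for all $t\in(-\infty,\infty)$, has a unique solution $v\in C^1((-\infty,\infty);V')$. Equivalently, it has a unique solution $u\in C^1((-\infty,\infty);V)$; indeed, whenever $v(t)=u(t)+\alpha^2Au(t)$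 for all $t$, with $u(t)\in V$, one has $v\in C^1((-\infty,\infty);V')$ if and only if $u\in C^1((-\infty,\infty);V)$. -/

import Mathlib

open MeasureTheory

namespace Bardina

noncomputable section

/-- Points of `ℝ³`. -/
abbrev Pt : Type := Fin 3 → ℝ

/-- Values of velocity fields. -/
abbrev Vec : Type := EuclideanSpace ℝ (Fin 3)

/-- Values of velocity gradients, with the Frobenius norm; the entry `(i, j)` is `∂ⱼ φᵢ`. -/
abbrev Mat : Type := EuclideanSpace ℝ (Fin 3 × Fin 3)

/-- The basic periodic box `Ω = [0, 2πL]³`. -/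
def box (L : ℝ) : Set Pt := Set.Icc 0 (fun _ => 2 * Real.pi * L)

/-- Lebesgue measure on `Ω`. -/
def boxMeasure (L : ℝ) : Measure Pt := volume.restrict (box L)

instance (L : ℝ) : IsFiniteMeasure (boxMeasure L) := by
  unfold boxMeasure box
  exact ⟨by simpa using isCompact_Icc.measure_lt_top⟩

/-- The phase `k · x / L`. -/
def phase (L : ℝ) (k : Fin 3 → ℤ) (x : Pt) : ℝ := (∑ i, (k i : ℝ) * x i) / L

/-- The real vector trigonometric polynomials that are `2πL`-periodic in each variable. -/
def trigPoly (L : ℝ) : Submodule ℝ (Pt → Vec) :=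
  Submodule.span ℝ
    {φ | ∃ (k : Fin 3 → ℤ) (a : Vec),
      (φ = fun x => Real.cos (phase L k x) • a) ∨ (φ = fun x => Real.sin (phase L k x) • a)}

/-- The gradient matrix `(∂ⱼ φᵢ)(x)`. -/
def grad (φ : Pt → Vec) (x : Pt) : Mat :=
  WithLp.toLp 2 fun q => fderiv ℝ φ x (Pi.single q.2 1) q.1

/-- The divergence `∑ᵢ ∂ᵢ φᵢ`. -/
def div (φ : Pt → Vec) (x : Pt) : ℝ := ∑ i, grad φ x (i, i)

theorem trigPoly_contDiff {L : ℝ} {φ : Pt → Vec} (h : φ ∈ trigPoly L) : ContDiff ℝ ⊤ φ := by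
  induction h using Submodule.span_induction with
  | mem φ h =>
    obtain ⟨k, a, rfl | rfl⟩ := h <;> unfold phase <;> fun_prop
  | zero => exact contDiff_const
  | add φ ψ _ _ h1 h2 => exact h1.add h2
  | smul c φ _ h => exact h.const_smul c

theorem trigPoly_diff {L : ℝ} {φ : Pt → Vec} (h : φ ∈ trigPoly L) (x : Pt) :
    DifferentiableAt ℝ φ x := (trigPoly_contDiff h).differentiable (by simp) x

theorem trigPoly_integrable {L : ℝ} {φ : Pt → Vec} (h : φ ∈ trigPoly L) :
    Integrable φ (boxMeasure L) :=
  (trigPoly_contDiff h).continuous.continuousOn.integrableOn_compact isCompact_Icc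

theorem grad_zero : grad 0 = 0 := by
  ext x q; simp [grad]

theorem grad_add {φ ψ : Pt → Vec} {x : Pt} (h1 : DifferentiableAt ℝ φ x)
    (h2 : DifferentiableAt ℝ ψ x) : grad (φ + ψ) x = grad φ x + grad ψ x := by
  ext q; simp [grad, fderiv_add h1 h2]

theorem grad_smul {φ : Pt → Vec} {x : Pt} (c : ℝ) (h1 : DifferentiableAt ℝ φ x) :
    grad (c • φ) x = c • grad φ x := by
  ext q; simp [grad, fderiv_const_smul h1]

/-- The space `𝒱` of divergence free vector trigonometric polynomials with zero mean over `Ω`. -/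
def solenoidal (L : ℝ) : Submodule ℝ (Pt → Vec) where
  carrier := {φ | φ ∈ trigPoly L ∧ (∀ x, div φ x = 0) ∧ ∫ x, φ x ∂boxMeasure L = 0}
  zero_mem' := ⟨Submodule.zero_mem _, by simp [div, grad_zero], by simp⟩
  add_mem' := by
    rintro φ ψ ⟨h1, h2, h3⟩ ⟨g1, g2, g3⟩
    refine ⟨Submodule.add_mem _ h1 g1, fun x => ?_, ?_⟩
    · have := h2 x
      have := g2 x
      simp_all [div, grad_add (trigPoly_diff h1 x) (trigPoly_diff g1 x), Finset.sum_add_distrib]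
    · simp only [Pi.add_apply]
      rw [integral_add (trigPoly_integrable h1) (trigPoly_integrable g1), h3, g3, add_zero]
  smul_mem' := by
    rintro c φ ⟨h1, h2, h3⟩
    refine ⟨Submodule.smul_mem _ c h1, fun x => ?_, ?_⟩
    · have := h2 x
      simp_all [div, grad_smul c (trigPoly_diff h1 x), ← Finset.mul_sum]
    · simp only [Pi.smul_apply]
      rw [integral_smul, h3, smul_zero]

/-- The Hilbert space `L²(Ω; ℝ³) × L²(Ω; ℝ³ˣ³)`. The space `H¹` embeds into it isometrically by
`u ↦ (u, ∇u)`, since `‖u‖_{H¹}² = |u|² + |∇u|²`. -/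
abbrev L2Pair (L : ℝ) : Type :=
  WithLp 2 (Lp Vec 2 (boxMeasure L) × Lp Mat 2 (boxMeasure L))

/-- The image of `𝒱` in `H¹`, that is, the set of all `(φ, ∇φ)` with `φ ∈ 𝒱`. -/
def solenoidalH1 (L : ℝ) : Submodule ℝ (L2Pair L) where
  carrier := {p | ∃ φ ∈ solenoidal L, p.fst =ᵐ[boxMeasure L] φ ∧ p.snd =ᵐ[boxMeasure L] grad φ}
  zero_mem' := ⟨0, Submodule.zero_mem _, by
    exact Lp.coeFn_zero _ _ _, by rw [grad_zero]; exact Lp.coeFn_zero _ _ _⟩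
  add_mem' := by
    rintro p q ⟨φ, h1, h2, h3⟩ ⟨ψ, g1, g2, g3⟩
    refine ⟨φ + ψ, Submodule.add_mem _ h1 g1, ?_, ?_⟩
    · exact (Lp.coeFn_add _ _).trans (h2.add g2)
    · refine (Lp.coeFn_add _ _).trans ?_
      filter_upwards [h3, g3] with x a b
      simp [a, b, grad_add (trigPoly_diff h1.1 x) (trigPoly_diff g1.1 x)]
  smul_mem' := by
    rintro c p ⟨φ, h1, h2, h3⟩
    refine ⟨c • φ, Submodule.smul_mem _ c h1, ?_, ?_⟩
    · exact (Lp.coeFn_smul _ _).trans (h2.const_smul c)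
    · refine (Lp.coeFn_smul _ _).trans ?_
      filter_upwards [h3] with x a
      simp [a, grad_smul c (trigPoly_diff h1.1 x)]

/-- The space `V`, the closure of `𝒱` in `H¹`. Its elements are the pairs `(u, ∇u)`. -/
def V (L : ℝ) : Submodule ℝ (L2Pair L) := (solenoidalH1 L).topologicalClosure

/-- The dual space `V'` of `V`. -/
abbrev V' (L : ℝ) : Type := StrongDual ℝ (V L)

/-- The vector field `u ∈ L²(Ω; ℝ³)` underlying an element of `V`. -/
def vel {L : ℝ} : V L →L[ℝ] Lp Vec 2 (boxMeasure L) :=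
  (WithLp.fstL 2 ℝ _ _).comp (V L).subtypeL

/-- The gradient `∇u ∈ L²(Ω; ℝ³ˣ³)` of an element of `V`. -/
def velGrad {L : ℝ} : V L →L[ℝ] Lp Mat 2 (boxMeasure L) :=
  (WithLp.sndL 2 ℝ _ _).comp (V L).subtypeL

/-- The embedding `V ⊂ H ⊂ V'`: `⟨u, w⟩ = ∫_Ω u · w` for `w ∈ V`. -/
def incl {L : ℝ} : V L →L[ℝ] V' L := (innerSL ℝ).bilinearComp vel vel

/-- The Stokes operator `A = -P_σ Δ`, extended to `A : V → V'`:
`⟨A u, w⟩ = ∫_Ω ∇u : ∇w` for `w ∈ V`. -/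
def stokes {L : ℝ} : V L →L[ℝ] V' L := (innerSL ℝ).bilinearComp velGrad velGrad

/-- The Fourier weight `1 + |k|²` of `H¹`. -/
def wt (k : Fin 3 → ℤ) : ℝ := 1 + ∑ i, (k i : ℝ) ^ 2

theorem wt_pos (k : Fin 3 → ℤ) : 0 < wt k := by unfold wt; positivity

theorem summable_wt : Summable fun k : Fin 3 → ℤ => (wt k ^ 2)⁻¹ := by
  let b := Pi.basisFun ℝ (Fin 3)
  let Λ := Submodule.span ℤ (Set.range b)
  have hr : Module.finrank ℤ Λ = 3 := by
    rw [ZLattice.rank ℝ Λ]; simp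
  have h1 := ZLattice.summable_norm_rpow Λ (-4) (by rw [hr]; norm_num)
  let ι : (Fin 3 → ℤ) → Λ := fun k => ∑ i, k i • ⟨b i, Submodule.subset_span ⟨i, rfl⟩⟩
  have hι : ∀ k i, (ι k : Pt) i = k i := by
    intro k i
    simp [ι, b, Finset.sum_apply, Pi.single_apply]
  have hinj : Function.Injective ι := by
    intro k l h
    funext i
    have := hι k i
    rw [h, hι l i] at this
    exact_mod_cast this.symm
  have h2 := h1.comp_injective hinj
  refine Summable.of_norm_bounded_eventually h2 ?_
  have : ∀ᶠ k : Fin 3 → ℤ in Filter.cofinite, k ≠ 0 := by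
    exact (Set.finite_singleton (0 : Fin 3 → ℤ)).compl_mem_cofinite
  filter_upwards [this] with k hk
  have hpos : 0 < ‖ι k‖ := by
    rw [norm_pos_iff]
    intro h
    apply hk
    funext i
    have := hι k i
    rw [h] at this
    simpa using this.symm
  have hle : ‖ι k‖ ^ 2 ≤ wt k := by
    obtain ⟨i, hi⟩ : ∃ i, ‖(ι k : Pt)‖ = ‖(ι k : Pt) i‖ := by
      obtain ⟨i, -, hi⟩ := Finset.exists_mem_eq_sup' (Finset.univ_nonempty (α := Fin 3))
        (fun i => ‖(ι k : Pt) i‖₊)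
      refine ⟨i, ?_⟩
      rw [Pi.norm_def, ← Finset.sup'_eq_sup Finset.univ_nonempty, hi]; rfl
    have h3 : ‖ι k‖ = ‖(ι k : Pt)‖ := rfl
    rw [h3, hi, hι, Real.norm_eq_abs, sq_abs, wt]
    have := Finset.single_le_sum (f := fun i => ((k i : ℝ)) ^ 2) (fun i _ => sq_nonneg _)
      (Finset.mem_univ i)
    linarith
  rw [Function.comp_apply, Real.norm_of_nonneg (by positivity), Real.rpow_neg hpos.le]
  apply inv_anti₀ (by positivity)
  rw [show (4:ℝ) = ((4:ℕ):ℝ) by norm_num, Real.rpow_natCast]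
  calc ‖ι k‖ ^ 4 = (‖ι k‖ ^ 2) ^ 2 := by ring
    _ ≤ _ := by gcongr

/-- The convolution bound behind the embedding of `H¹` into `L⁴`. -/
theorem conv_bound : ∃ K : ℝ, 0 ≤ K ∧ ∀ (s t : Finset (Fin 3 → ℤ)) (a : (Fin 3 → ℤ) → ℝ),
    (∀ k, 0 ≤ a k) → (∀ k ∉ s, a k = 0) →
    ∑ x ∈ t, (∑ k ∈ s, a k * a (x - k)) ^ 2 ≤ K * (∑ k ∈ s, wt k * a k ^ 2) ^ 2 := by
  refine ⟨∑' k, (wt k ^ 2)⁻¹, tsum_nonneg fun k => by positivity, ?_⟩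
  intro s t a ha hs
  have key : ∀ x, ∑ k ∈ s, (wt k * wt (x - k))⁻¹ ≤ ∑' k, (wt k ^ 2)⁻¹ := by
    intro x
    have h1 : ∑ k ∈ s, (wt k ^ 2)⁻¹ ≤ ∑' k, (wt k ^ 2)⁻¹ :=
      summable_wt.sum_le_tsum s fun k _ => by positivity
    have h2 : ∑ k ∈ s, (wt (x - k) ^ 2)⁻¹ ≤ ∑' k, (wt k ^ 2)⁻¹ := by
      have e : ∑ k ∈ s, (wt (x - k) ^ 2)⁻¹ = ∑ k ∈ s.map (Equiv.subLeft x).toEmbedding,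
          (wt k ^ 2)⁻¹ := by simp
      rw [e]
      exact summable_wt.sum_le_tsum _ fun k _ => by positivity
    have h3 : ∀ k ∈ s, (wt k * wt (x - k))⁻¹ ≤ ((wt k ^ 2)⁻¹ + (wt (x - k) ^ 2)⁻¹) / 2 := by
      intro k _
      have := sq_nonneg ((wt k)⁻¹ - (wt (x - k))⁻¹)
      rw [mul_inv, ← inv_pow, ← inv_pow]
      nlinarith
    have h4 := Finset.sum_le_sum h3
    rw [← Finset.sum_div, Finset.sum_add_distrib] at h4
    linarith
  have step : ∀ x ∈ t, (∑ k ∈ s, a k * a (x - k)) ^ 2 ≤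
      (∑' k, (wt k ^ 2)⁻¹) * ∑ k ∈ s, (wt k * a k ^ 2) * (wt (x - k) * a (x - k) ^ 2) := by
    intro x _
    have hcs := Finset.sum_mul_sq_le_sq_mul_sq s (fun k => √((wt k * wt (x - k))⁻¹))
      (fun k => √(wt k * wt (x - k)) * (a k * a (x - k)))
    have e1 : ∀ k, √((wt k * wt (x - k))⁻¹) * (√(wt k * wt (x - k)) * (a k * a (x - k)))
        = a k * a (x - k) := by
      intro k
      have : 0 < wt k * wt (x - k) := mul_pos (wt_pos _) (wt_pos _)
      rw [← mul_assoc, ← Real.sqrt_mul (by positivity), inv_mul_cancel₀ this.ne']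
      simp
    have e2 : ∀ k, √((wt k * wt (x - k))⁻¹) ^ 2 = (wt k * wt (x - k))⁻¹ := fun k =>
      Real.sq_sqrt (inv_nonneg.2 (mul_pos (wt_pos _) (wt_pos _)).le)
    have e3 : ∀ k, (√(wt k * wt (x - k)) * (a k * a (x - k))) ^ 2 =
        (wt k * a k ^ 2) * (wt (x - k) * a (x - k) ^ 2) := fun k => by
      rw [mul_pow, Real.sq_sqrt (mul_pos (wt_pos _) (wt_pos _)).le]; ring
    simp only [e1, e2, e3] at hcs
    refine hcs.trans ?_
    gcongr
    · exact Finset.sum_nonneg fun k _ => mul_nonneg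
        (mul_nonneg (wt_pos _).le (sq_nonneg _)) (mul_nonneg (wt_pos _).le (sq_nonneg _))
    · exact key x
  refine (Finset.sum_le_sum step).trans ?_
  rw [← Finset.mul_sum, Finset.sum_comm]
  refine mul_le_mul_of_nonneg_left ?_ (tsum_nonneg fun k => by positivity)
  rw [sq, Finset.sum_mul]
  refine Finset.sum_le_sum fun k _ => ?_
  rw [← Finset.mul_sum]
  refine mul_le_mul_of_nonneg_left ?_ (mul_nonneg (wt_pos _).le (sq_nonneg _))
  have e : ∑ x ∈ t, wt (x - k) * a (x - k) ^ 2 =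
      ∑ y ∈ t.map (Equiv.subRight k).toEmbedding, wt y * a y ^ 2 := by simp
  rw [e]
  have : ∑ y ∈ t.map (Equiv.subRight k).toEmbedding, wt y * a y ^ 2 ≤
      ∑ y ∈ t.map (Equiv.subRight k).toEmbedding ∪ s, wt y * a y ^ 2 :=
    Finset.sum_le_sum_of_subset_of_nonneg Finset.subset_union_left
      fun y _ _ => mul_nonneg (wt_pos _).le (sq_nonneg _)
  refine this.trans (le_of_eq ?_)
  symm
  apply Finset.sum_subset Finset.subset_union_right
  intro y _ hy
  simp [hs y hy]

/-- The complex mode `e^{i k · x / L}`. -/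
def mode (L : ℝ) (k : Fin 3 → ℤ) (x : Pt) : ℂ := Complex.exp (Complex.I * phase L k x)

/-- The complex trigonometric polynomial with given Fourier coefficients. -/
def ev (L : ℝ) : ((Fin 3 → ℤ) →₀ ℂ) →ₗ[ℂ] (Pt → ℂ) := Finsupp.linearCombination ℂ (mode L)

theorem ev_apply (L : ℝ) (c : (Fin 3 → ℤ) →₀ ℂ) (x : Pt) :
    ev L c x = ∑ k ∈ c.support, c k * mode L k x := by
  simp [ev, Finsupp.linearCombination_apply, Finsupp.sum, Finset.sum_apply]

theorem mode_add (L : ℝ) (k l : Fin 3 → ℤ) (x : Pt) :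
    mode L (k + l) x = mode L k x * mode L l x := by
  rw [mode, mode, mode, ← Complex.exp_add]
  congr 1
  simp [phase, add_mul, Finset.sum_add_distrib, add_div, mul_add]

theorem mode_cont (L : ℝ) (k : Fin 3 → ℤ) : Continuous (mode L k) := by
  unfold mode phase; fun_prop

theorem mode_zero (L : ℝ) (x : Pt) : mode L 0 x = 1 := by simp [mode, phase]

theorem mode_conj (L : ℝ) (k : Fin 3 → ℤ) (x : Pt) :
    (starRingEnd ℂ) (mode L k x) = mode L (-k) x := by
  rw [mode, mode, ← Complex.exp_conj]
  congr 1
  simp [phase, neg_div]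

theorem integral_mode {L : ℝ} (hL : 0 < L) (k : Fin 3 → ℤ) :
    ∫ x, mode L k x ∂boxMeasure L = if k = 0 then (((2 * Real.pi * L) ^ 3 : ℝ) : ℂ) else 0 := by
  have hm : boxMeasure L = Measure.pi fun _ : Fin 3 =>
      (volume : Measure ℝ).restrict (Set.Icc 0 (2 * Real.pi * L)) := by
    rw [boxMeasure, box, ← Measure.restrict_pi_pi, ← Set.pi_univ_Icc]
    rfl
  have hp : ∀ x, mode L k x = ∏ i, Complex.exp (Complex.I * k i / L * x i) := by
    intro x
    rw [← Complex.exp_sum, mode]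
    congr 1
    simp only [phase, Complex.ofReal_div, Complex.ofReal_sum, Complex.ofReal_mul,
      Complex.ofReal_intCast, Finset.sum_div, Finset.mul_sum]
    refine Finset.sum_congr rfl fun i _ => ?_
    ring
  simp_rw [hp]
  rw [hm, integral_fintype_prod_eq_prod (𝕜 := ℂ)
    (fun (i : Fin 3) (y : ℝ) => Complex.exp (Complex.I * k i / L * y))]
  have h1 : ∀ i, ∫ y, Complex.exp (Complex.I * k i / L * y)
      ∂((volume : Measure ℝ).restrict (Set.Icc 0 (2 * Real.pi * L))) =
      if k i = 0 then ((2 * Real.pi * L : ℝ) : ℂ) else 0 := by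
    intro i
    have hnn : 0 ≤ 2 * Real.pi * L := by positivity
    rw [integral_Icc_eq_integral_Ioc, ← intervalIntegral.integral_of_le hnn]
    split_ifs with h
    · simp [h]
    · rw [integral_exp_mul_complex]
      · have hL' : (L : ℂ) ≠ 0 := by exact_mod_cast hL.ne'
        have : Complex.I * k i / L * ((2 * Real.pi * L : ℝ) : ℂ) =
            k i * (2 * Real.pi * Complex.I) := by
          push_cast; field_simp
        rw [this, Complex.exp_int_mul_two_pi_mul_I]; simp
      · have hL' : (L : ℂ) ≠ 0 := by exact_mod_cast hL.ne'
        have : (k i : ℂ) ≠ 0 := by exact_mod_cast h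
        simp [*]
  simp_rw [h1]
  split_ifs with h
  · simp [h]
  · obtain ⟨i, hi⟩ : ∃ i, k i ≠ 0 := by
      by_contra! hc; exact h (funext hc)
    exact Finset.prod_eq_zero (Finset.mem_univ i) (by simp [hi])

theorem mode_integrable (L : ℝ) (k : Fin 3 → ℤ) : Integrable (mode L k) (boxMeasure L) :=
  (mode_cont L k).continuousOn.integrableOn_compact isCompact_Icc

theorem parseval {L : ℝ} (hL : 0 < L) (c : (Fin 3 → ℤ) →₀ ℂ) :
    ∫ x, ‖ev L c x‖ ^ 2 ∂boxMeasure L = (2 * Real.pi * L) ^ 3 * ∑ k ∈ c.support, ‖c k‖ ^ 2 := by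
  have h : ∀ x, ((‖ev L c x‖ ^ 2 : ℝ) : ℂ) = ∑ k ∈ c.support, ∑ l ∈ c.support,
      (c k * (starRingEnd ℂ) (c l)) * mode L (k - l) x := by
    intro x
    rw [Complex.ofReal_pow, ← Complex.mul_conj', ev_apply, map_sum, Finset.sum_mul_sum]
    refine Finset.sum_congr rfl fun k _ => Finset.sum_congr rfl fun l _ => ?_
    rw [map_mul, mode_conj, sub_eq_add_neg, mode_add]; ring
  have h2 : ((∫ x, ‖ev L c x‖ ^ 2 ∂boxMeasure L : ℝ) : ℂ) =
      (((2 * Real.pi * L) ^ 3 * ∑ k ∈ c.support, ‖c k‖ ^ 2 : ℝ) : ℂ) := by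
    rw [← integral_complex_ofReal]
    simp_rw [h]
    rw [integral_finsetSum _ fun k _ => integrable_finsetSum _ fun l _ =>
      (mode_integrable L _).const_mul _]
    simp_rw [integral_finsetSum _ fun l _ => (mode_integrable L _).const_mul _,
      integral_const_mul, integral_mode hL]
    push_cast
    rw [Finset.mul_sum]
    refine Finset.sum_congr rfl fun k hk => ?_
    rw [Finset.sum_eq_single k]
    · simp only [sub_self, if_true]
      rw [Complex.mul_conj']; ring
    · intro l _ hl
      rw [if_neg (sub_ne_zero.2 hl.symm), mul_zero]
    · intro h; exact absurd hk h
  exact_mod_cast h2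

theorem ev_L4 : ∃ K : ℝ, 0 ≤ K ∧ ∀ (L : ℝ), 0 < L → ∀ c : (Fin 3 → ℤ) →₀ ℂ,
    ∫ x, ‖ev L c x‖ ^ 4 ∂boxMeasure L ≤
      K * (2 * Real.pi * L) ^ 3 * (∑ k ∈ c.support, wt k * ‖c k‖ ^ 2) ^ 2 := by
  obtain ⟨K, hK, hb⟩ := conv_bound
  refine ⟨K, hK, fun L hL c => ?_⟩
  let d : (Fin 3 → ℤ) →₀ ℂ :=
    ∑ k ∈ c.support, ∑ l ∈ c.support, Finsupp.single (k + l) (c k * c l)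
  have hd : ∀ x, ev L d x = ev L c x ^ 2 := by
    intro x
    have : ev L d = ∑ k ∈ c.support, ∑ l ∈ c.support, (c k * c l) • mode L (k + l) := by
      simp only [d, ev, map_sum, Finsupp.linearCombination_single]
    rw [this, ev_apply, sq, Finset.sum_mul_sum]
    simp only [Finset.sum_apply, Pi.smul_apply, smul_eq_mul, mode_add]
    refine Finset.sum_congr rfl fun k _ => Finset.sum_congr rfl fun l _ => ?_
    ring
  have hdx : ∀ x, d x = ∑ k ∈ c.support, c k * c (x - k) := by
    intro x
    simp only [d, Finsupp.finsetSum_apply, Finsupp.single_apply]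
    refine Finset.sum_congr rfl fun k _ => ?_
    by_cases hx : x - k ∈ c.support
    · rw [Finset.sum_eq_single (x - k)]
      · simp
      · intro l _ hl
        rw [if_neg]
        intro h; exact hl (eq_sub_of_add_eq' h)
      · intro h; exact absurd hx h
    · rw [Finsupp.notMem_support_iff.1 hx, mul_zero]
      refine Finset.sum_eq_zero fun l hl => ?_
      rw [if_neg]
      rintro rfl
      rw [add_sub_cancel_left] at hx
      exact hx hl
  have e : ∀ x, ‖ev L c x‖ ^ 4 = ‖ev L d x‖ ^ 2 := fun x => by
    rw [hd, norm_pow]; ring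
  simp_rw [e]
  rw [parseval hL, mul_comm K, mul_assoc ((2 * Real.pi * L) ^ 3)]
  have hv : (0 : ℝ) ≤ (2 * Real.pi * L) ^ 3 := by positivity
  refine mul_le_mul_of_nonneg_left ?_ hv
  refine le_trans (Finset.sum_le_sum fun x _ => ?_)
    (hb c.support d.support (fun k => ‖c k‖) (fun k => norm_nonneg _) (fun k hk => by
      rw [Finsupp.notMem_support_iff.1 hk, norm_zero]))
  rw [hdx]
  gcongr
  exact (norm_sum_le _ _).trans (le_of_eq (by simp))

/-- The Fourier multiplier of `∂ⱼ`. -/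
def mult (L : ℝ) (j : Fin 3) : ((Fin 3 → ℤ) →₀ ℂ) →ₗ[ℂ] ((Fin 3 → ℤ) →₀ ℂ) :=
  Finsupp.linearCombination ℂ fun k => Finsupp.single k (Complex.I * k j / L)

theorem mult_apply (L : ℝ) (j : Fin 3) (c : (Fin 3 → ℤ) →₀ ℂ) (k : Fin 3 → ℤ) :
    mult L j c k = c k * (Complex.I * k j / L) := by
  simp only [mult, Finsupp.linearCombination_apply, Finsupp.sum, Finsupp.finsetSum_apply,
    Finsupp.smul_apply, Finsupp.single_apply, smul_eq_mul]
  by_cases hk : k ∈ c.support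
  · rw [Finset.sum_eq_single k]
    · simp
    · intro l _ hl; simp [hl]
    · intro h; exact absurd hk h
  · rw [Finsupp.notMem_support_iff.1 hk, zero_mul]
    refine Finset.sum_eq_zero fun l hl => ?_
    rw [if_neg, mul_zero]
    rintro rfl; exact hk hl

theorem mult_single (L : ℝ) (j : Fin 3) (k : Fin 3 → ℤ) (a : ℂ) :
    mult L j (Finsupp.single k a) = Finsupp.single k (a * (Complex.I * k j / L)) := by
  simp [mult, Finsupp.linearCombination_single]

theorem phase_hasFDerivAt (L : ℝ) (k : Fin 3 → ℤ) (x : Pt) :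
    HasFDerivAt (phase L k)
      (L⁻¹ • ∑ i, (k i : ℝ) • ContinuousLinearMap.proj (R := ℝ) (φ := fun _ : Fin 3 => ℝ) i) x := by
  have : phase L k =
      ⇑(L⁻¹ • ∑ i, (k i : ℝ) • ContinuousLinearMap.proj (R := ℝ) (φ := fun _ : Fin 3 => ℝ) i) := by
    ext y
    simp [phase, div_eq_inv_mul]
  rw [this]
  exact ContinuousLinearMap.hasFDerivAt _

theorem ev_single (L : ℝ) (k : Fin 3 → ℤ) (a : ℂ) (x : Pt) :
    ev L (Finsupp.single k a) x = a * mode L k x := by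
  rw [ev, Finsupp.linearCombination_single]; rfl

theorem cos_phase (L : ℝ) (k : Fin 3 → ℤ) (x : Pt) :
    ((Real.cos (phase L k x) : ℝ) : ℂ) = (mode L k x + mode L (-k) x) / 2 := by
  have : mode L (-k) x = Complex.exp (-(phase L k x : ℂ) * Complex.I) := by
    rw [mode]; congr 1; simp [phase, neg_div]; ring
  rw [this, mode, Complex.ofReal_cos, Complex.cos, mul_comm Complex.I]

theorem sin_phase (L : ℝ) (k : Fin 3 → ℤ) (x : Pt) :
    ((Real.sin (phase L k x) : ℝ) : ℂ) = (mode L (-k) x - mode L k x) * Complex.I / 2 := by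
  have : mode L (-k) x = Complex.exp (-(phase L k x : ℂ) * Complex.I) := by
    rw [mode]; congr 1; simp [phase, neg_div]; ring
  rw [this, mode, Complex.ofReal_sin, Complex.sin, mul_comm Complex.I]

theorem trigPoly_coeff {L : ℝ} {φ : Pt → Vec} (h : φ ∈ trigPoly L) (i : Fin 3) :
    ∃ c : (Fin 3 → ℤ) →₀ ℂ, (∀ x, ((φ x i : ℝ) : ℂ) = ev L c x) ∧
      ∀ j x, ((grad φ x (i, j) : ℝ) : ℂ) = ev L (mult L j c) x := by
  induction h using Submodule.span_induction with
  | mem φ h =>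
    obtain ⟨k, a, rfl | rfl⟩ := h
    · refine ⟨Finsupp.single k ((a i : ℂ) / 2) + Finsupp.single (-k) ((a i : ℂ) / 2),
        fun x => ?_, fun j x => ?_⟩
      · rw [map_add, Pi.add_apply, ev_single, ev_single, PiLp.smul_apply, smul_eq_mul,
          Complex.ofReal_mul, cos_phase]
        ring
      · have hd := ((phase_hasFDerivAt L k x).cos.smul_const a).fderiv
        have : grad (fun x => Real.cos (phase L k x) • a) x (i, j) =
            -Real.sin (phase L k x) * (k j / L) * a i := by
          simp only [grad, hd]
          simp [-mul_eq_mul_right_iff, -mul_eq_mul_left_iff, Pi.single_apply]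
          try ring
        rw [this, map_add, mult_single, mult_single, map_add, Pi.add_apply, ev_single, ev_single]
        push_cast [-Complex.ofReal_sin]
        rw [sin_phase, Pi.neg_apply]
        push_cast
        ring
    · refine ⟨Finsupp.single k (-Complex.I * (a i : ℂ) / 2) +
          Finsupp.single (-k) (Complex.I * (a i : ℂ) / 2), fun x => ?_, fun j x => ?_⟩
      · rw [map_add, Pi.add_apply, ev_single, ev_single, PiLp.smul_apply, smul_eq_mul,
          Complex.ofReal_mul, sin_phase]
        ring
      · have hd := ((phase_hasFDerivAt L k x).sin.smul_const a).fderiv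
        have : grad (fun x => Real.sin (phase L k x) • a) x (i, j) =
            Real.cos (phase L k x) * (k j / L) * a i := by
          simp only [grad, hd]
          simp [-mul_eq_mul_right_iff, -mul_eq_mul_left_iff, Pi.single_apply]
          try ring
        rw [this, map_add, mult_single, mult_single, map_add, Pi.add_apply, ev_single, ev_single]
        push_cast [-Complex.ofReal_cos]
        rw [cos_phase, Pi.neg_apply]
        push_cast
        ring_nf
        rw [Complex.I_sq]
        ring
  | zero => exact ⟨0, by simp, by simp [grad_zero]⟩
  | add φ ψ hφ hψ h1 h2 =>
    obtain ⟨c, hc, hc'⟩ := h1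
    obtain ⟨d, hd, hd'⟩ := h2
    refine ⟨c + d, fun x => by simp [hc, hd], fun j x => ?_⟩
    rw [grad_add (trigPoly_diff hφ x) (trigPoly_diff hψ x)]
    simp [hc', hd']
  | smul r φ hφ h =>
    obtain ⟨c, hc, hc'⟩ := h
    refine ⟨(r : ℂ) • c, fun x => by simp [hc], fun j x => ?_⟩
    rw [grad_smul r (trigPoly_diff hφ x)]
    simp [hc']

theorem grad_continuous {L : ℝ} {φ : Pt → Vec} (h : φ ∈ trigPoly L) : Continuous (grad φ) := by
  have h1 := (trigPoly_contDiff h).continuous_fderiv (by simp)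
  unfold grad
  fun_prop

theorem cont_integrable (L : ℝ) {g : Pt → ℝ} (h : Continuous g) :
    Integrable g (boxMeasure L) :=
  h.continuousOn.integrableOn_compact isCompact_Icc

theorem lp_normsq {E : Type} [NormedAddCommGroup E] [InnerProductSpace ℝ E] {μ : Measure Pt}
    (g : Lp E 2 μ) : ‖g‖ ^ 2 = ∫ x, ‖g x‖ ^ 2 ∂μ := by
  rw [← real_inner_self_eq_norm_sq, L2.inner_def]
  simp

theorem comp_bound₁ {L : ℝ} {g : Lp Vec 2 (boxMeasure L)} {φ : Pt → Vec} (hφ : Continuous φ)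
    (h : g =ᵐ[boxMeasure L] φ) (i : Fin 3) :
    ∫ x, |φ x i| ^ 2 ∂boxMeasure L ≤ ‖g‖ ^ 2 := by
  have e := integral_congr_ae (h.fun_comp (fun y => ‖y‖ ^ 2))
  simp only [Function.comp_def] at e
  rw [lp_normsq, e]
  refine integral_mono (cont_integrable L (by fun_prop)) (cont_integrable L (by fun_prop)) ?_
  intro x
  have := PiLp.norm_apply_le (φ x) i
  simp only
  gcongr
  exact this

theorem comp_bound₂ {L : ℝ} {g : Lp Mat 2 (boxMeasure L)} {G : Pt → Mat} (hG : Continuous G)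
    (h : g =ᵐ[boxMeasure L] G) (i : Fin 3) :
    ∑ j, ∫ x, |G x (i, j)| ^ 2 ∂boxMeasure L ≤ ‖g‖ ^ 2 := by
  have e := integral_congr_ae (h.fun_comp (fun y => ‖y‖ ^ 2))
  simp only [Function.comp_def] at e
  have hc : ∀ j, Continuous fun x => |G x (i, j)| ^ 2 := fun j => by fun_prop
  rw [lp_normsq, e, ← integral_finsetSum _ fun j _ => cont_integrable L (hc j)]
  refine integral_mono (cont_integrable L (continuous_finsetSum _ fun j _ => hc j))
    (cont_integrable L (hG.norm.pow 2)) ?_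
  intro x
  simp only [EuclideanSpace.norm_sq_eq, Real.norm_eq_abs]
  rw [Fintype.sum_prod_type]
  have hn : ∀ i' ∈ Finset.univ, 0 ≤ ∑ j : Fin 3, |G x (i', j)| ^ 2 :=
    fun i' _ => Finset.sum_nonneg fun j _ => sq_nonneg _
  exact Finset.single_le_sum hn (Finset.mem_univ i)

theorem trig_L4 : ∀ L : ℝ, 0 < L → ∃ C : ℝ, 0 ≤ C ∧ ∀ p : L2Pair L, ∀ φ ∈ trigPoly L,
    p.fst =ᵐ[boxMeasure L] φ → p.snd =ᵐ[boxMeasure L] grad φ → ∀ i,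
    ∫ x, |φ x i| ^ 4 ∂boxMeasure L ≤ (C * ‖p‖) ^ 4 := by
  obtain ⟨K, hK, hb⟩ := ev_L4
  intro L hL
  set vol : ℝ := (2 * Real.pi * L) ^ 3 with hvol
  have hv : 0 < vol := by positivity
  have hD : 0 ≤ K / vol * (1 + L ^ 2) ^ 2 := by positivity
  refine ⟨√√(K / vol * (1 + L ^ 2) ^ 2), by positivity, fun p φ hφ h1 h2 i => ?_⟩
  obtain ⟨c, hc, hc'⟩ := trigPoly_coeff hφ i
  have hφc := (trigPoly_contDiff hφ).continuous
  have hgc := grad_continuous hφ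
  have e1 : ∫ x, |φ x i| ^ 2 ∂boxMeasure L = vol * ∑ k ∈ c.support, ‖c k‖ ^ 2 := by
    rw [← parseval hL]
    simp [← hc]
  have e2 : ∀ j, L ^ 2 * ∫ x, |grad φ x (i, j)| ^ 2 ∂boxMeasure L =
      vol * ∑ k ∈ c.support, (k j : ℝ) ^ 2 * ‖c k‖ ^ 2 := by
    intro j
    have : ∫ x, |grad φ x (i, j)| ^ 2 ∂boxMeasure L =
        vol * ∑ k ∈ c.support, ‖mult L j c k‖ ^ 2 := by
      have hs : ∑ k ∈ (mult L j c).support, ‖mult L j c k‖ ^ 2 =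
          ∑ k ∈ c.support, ‖mult L j c k‖ ^ 2 := by
        refine Finset.sum_subset ?_ ?_
        · intro k hk
          rw [Finsupp.mem_support_iff, mult_apply] at hk
          rw [Finsupp.mem_support_iff]
          exact left_ne_zero_of_mul hk
        · intro k _ hk
          rw [Finsupp.notMem_support_iff.1 hk, norm_zero, zero_pow two_ne_zero]
      rw [← hs, ← parseval hL]; simp [← hc']
    rw [this, mul_left_comm, Finset.mul_sum]
    congr 1
    refine Finset.sum_congr rfl fun k _ => ?_
    rw [mult_apply]
    simp only [norm_mul, norm_div, Complex.norm_I, Complex.norm_real, Complex.norm_intCast,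
      Real.norm_eq_abs, abs_of_pos hL]
    rw [mul_pow, div_pow, mul_pow, sq_abs]
    field_simp
  have b1 := comp_bound₁ hφc h1 i
  have b2 := comp_bound₂ hgc h2 i
  have key : vol * ∑ k ∈ c.support, wt k * ‖c k‖ ^ 2 ≤ (1 + L ^ 2) * ‖p‖ ^ 2 := by
    have : vol * ∑ k ∈ c.support, wt k * ‖c k‖ ^ 2 = ∫ x, |φ x i| ^ 2 ∂boxMeasure L +
        L ^ 2 * ∑ j, ∫ x, |grad φ x (i, j)| ^ 2 ∂boxMeasure L := by
      have e3 : L ^ 2 * ∑ j, ∫ x, |grad φ x (i, j)| ^ 2 ∂boxMeasure L =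
          vol * ∑ j, ∑ k ∈ c.support, (k j : ℝ) ^ 2 * ‖c k‖ ^ 2 := by
        rw [Finset.mul_sum, Finset.mul_sum]
        exact Finset.sum_congr rfl fun j _ => e2 j
      rw [e1, e3, ← mul_add, Finset.sum_comm, ← Finset.sum_add_distrib]
      congr 1
      refine Finset.sum_congr rfl fun k _ => ?_
      rw [wt, ← Finset.sum_mul]; ring
    rw [this, WithLp.prod_norm_sq_eq_of_L2]
    nlinarith [sq_nonneg L, sq_nonneg ‖p.fst‖, sq_nonneg ‖p.snd‖,
      mul_nonneg (sq_nonneg L) (sq_nonneg ‖p.fst‖),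
      mul_le_mul_of_nonneg_left b2 (sq_nonneg L)]
  have h4 := hb L hL c
  have e4 : ∫ x, |φ x i| ^ 4 ∂boxMeasure L = ∫ x, ‖ev L c x‖ ^ 4 ∂boxMeasure L := by
    simp [← hc]
  rw [e4]
  refine h4.trans ?_
  rw [mul_pow _ ‖p‖]
  have s4 : √√(K / vol * (1 + L ^ 2) ^ 2) ^ 4 = K / vol * (1 + L ^ 2) ^ 2 := by
    rw [show 4 = 2 * 2 by norm_num, pow_mul, Real.sq_sqrt (Real.sqrt_nonneg _), Real.sq_sqrt hD]
  rw [s4]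
  have hS : 0 ≤ ∑ k ∈ c.support, wt k * ‖c k‖ ^ 2 :=
    Finset.sum_nonneg fun k _ => mul_nonneg (wt_pos k).le (sq_nonneg _)
  calc K * vol * (∑ k ∈ c.support, wt k * ‖c k‖ ^ 2) ^ 2
      = K / vol * (vol * ∑ k ∈ c.support, wt k * ‖c k‖ ^ 2) ^ 2 := by field_simp
    _ ≤ K / vol * ((1 + L ^ 2) * ‖p‖ ^ 2) ^ 2 := by gcongr
    _ = _ := by ring

/-- The Sobolev embedding of `V` into `L⁴(Ω; ℝ³)`. -/
theorem V_L4 (L : ℝ) : ∃ C : ℝ, 0 ≤ C ∧ ∀ (u : V L) (i : Fin 3),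
    eLpNorm (fun x => vel u x i) 4 (boxMeasure L) ≤ ENNReal.ofReal (C * ‖u‖) := by
  rcases le_or_gt L 0 with hL | hL
  · refine ⟨0, le_rfl, fun u i => ?_⟩
    have : boxMeasure L = 0 := by
      rw [boxMeasure, Measure.restrict_eq_zero, box, Real.volume_Icc_pi]
      simp
      nlinarith [Real.pi_pos]
    have h0 : ∀ᵐ x ∂boxMeasure L, vel u x i = 0 := by
      have hz : ∀ s, boxMeasure L s = 0 := fun s => by rw [this]; rfl
      exact ae_iff.2 (hz _)
    rw [eLpNorm_congr_ae h0]; simp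
  obtain ⟨C, hC, hb⟩ := trig_L4 L hL
  refine ⟨C, hC, fun u i => ?_⟩
  obtain ⟨p, hp, hlim⟩ := mem_closure_iff_seq_limit.1 u.2
  choose φ hφ h1 h2 using hp
  have hfst : Filter.Tendsto (fun n => (p n).fst) Filter.atTop (nhds (vel u)) :=
    ((WithLp.fstL 2 ℝ _ _).continuous.tendsto u.1).comp hlim
  obtain ⟨ns, hns, hae⟩ := (tendstoInMeasure_of_tendsto_Lp hfst).exists_seq_tendsto_ae
  have hae' : ∀ᵐ x ∂boxMeasure L,
      Filter.Tendsto (fun n => (p (ns n)).fst x i) Filter.atTop (nhds (vel u x i)) := by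
    filter_upwards [hae] with x hx
    exact ((EuclideanSpace.proj (𝕜 := ℝ) i).continuous.tendsto _).comp hx
  have hbd : ∀ n, eLpNorm (fun x => (p n).fst x i) 4 (boxMeasure L) ≤
      ENNReal.ofReal (C * ‖p n‖) := by
    intro n
    have e : (fun x => (p n).fst x i) =ᵐ[boxMeasure L] fun x => φ n x i :=
      (h1 n).fun_comp fun y => y i
    rw [eLpNorm_congr_ae e]
    have hc := (trigPoly_contDiff (hφ n).1).continuous
    have hm : MemLp (fun x => φ n x i) 4 (boxMeasure L) := by
      refine ⟨by fun_prop, ?_⟩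
      rw [eLpNorm_lt_top_iff_lintegral_rpow_enorm_lt_top (by norm_num) (by norm_num)]
      have := (cont_integrable L (g := fun x => (φ n x i) ^ 4) (by fun_prop)).2
      simpa [HasFiniteIntegral] using this
    rw [hm.eLpNorm_eq_integral_rpow_norm (by norm_num) (by norm_num)]
    refine ENNReal.ofReal_le_ofReal ?_
    have := hb (p n) (φ n) (hφ n).1 (h1 n) (h2 n) i
    have h0 : 0 ≤ C * ‖p n‖ := by positivity
    have e4 : ∀ y : ℝ, y ^ (ENNReal.toReal 4) = y ^ 4 := fun y => by
      rw [show ENNReal.toReal 4 = ((4 : ℕ) : ℝ) by norm_num, Real.rpow_natCast]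
    simp only [e4, Real.norm_eq_abs]
    refine (Real.rpow_le_rpow (integral_nonneg fun x => by positivity) this (by simp)).trans ?_
    rw [← e4, Real.rpow_rpow_inv h0 (by norm_num)]
  refine (Lp.eLpNorm_lim_le_liminf_eLpNorm (f := fun n x => (p (ns n)).fst x i)
    (fun n => ?_) _ hae').trans ?_
  · exact ((EuclideanSpace.proj (𝕜 := ℝ) i).continuous.comp_aestronglyMeasurable
      (Lp.aestronglyMeasurable _))
  · have ht : Filter.Tendsto (fun n => ENNReal.ofReal (C * ‖p (ns n)‖)) Filter.atTop
        (nhds (ENNReal.ofReal (C * ‖u‖))) :=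
      ENNReal.tendsto_ofReal (((hlim.comp hns.tendsto_atTop).norm).const_mul C)
    rw [← ht.liminf_eq]
    exact Filter.liminf_le_liminf (Filter.Eventually.of_forall fun n => hbd _)


theorem triple_bound {μ : Measure Pt} {a b c : Pt → ℝ} (ha : MemLp a 4 μ) (hb : MemLp b 2 μ)
    (hc : MemLp c 4 μ) : Integrable (fun x => a x * b x * c x) μ ∧
    ‖∫ x, a x * b x * c x ∂μ‖ ≤
      (eLpNorm a 4 μ).toReal * (eLpNorm b 2 μ).toReal * (eLpNorm c 4 μ).toReal := by
  have : ENNReal.HolderTriple 4 4 2 := ⟨by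
    rw [← ENNReal.toReal_eq_toReal_iff' (by simp) (by simp), ENNReal.toReal_add (by simp) (by simp)]
    norm_num⟩
  have hac : MemLp (a • c) 2 μ := MemLp.smul hc ha
  have hbac : MemLp (b • (a • c)) 1 μ := MemLp.smul hac hb
  have e : (fun x => a x * b x * c x) = b • (a • c) := by
    ext x; simp; ring
  have hi := memLp_one_iff_integrable.1 hbac
  rw [e]
  refine ⟨hi, ?_⟩
  have h1 : eLpNorm (b • (a • c)) 1 μ ≤
      eLpNorm b 2 μ * (eLpNorm a 4 μ * eLpNorm c 4 μ) :=
    (eLpNorm_smul_le_mul_eLpNorm hac.1 hb.1).trans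
      (mul_le_mul_right (eLpNorm_smul_le_mul_eLpNorm (r := 2) hc.1 ha.1) _)
  have h2 : ‖∫ x, (b • (a • c)) x ∂μ‖ ≤ (eLpNorm (b • (a • c)) 1 μ).toReal := by
    rw [eLpNorm_one_eq_lintegral_enorm, ← integral_norm_eq_lintegral_enorm hi.1]
    exact norm_integral_le_integral_norm _
  refine h2.trans ((ENNReal.toReal_mono ?_ h1).trans (le_of_eq ?_))
  · exact ENNReal.mul_ne_top hb.2.ne (ENNReal.mul_ne_top ha.2.ne hc.2.ne)
  · rw [ENNReal.toReal_mul, ENNReal.toReal_mul]; ring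

theorem vel_memLp {L : ℝ} (u : V L) (i : Fin 3) :
    MemLp (fun x => vel u x i) 4 (boxMeasure L) := by
  obtain ⟨C, _, h⟩ := V_L4 L
  exact ⟨(EuclideanSpace.proj (𝕜 := ℝ) i).continuous.comp_aestronglyMeasurable
    (Lp.aestronglyMeasurable _), (h u i).trans_lt ENNReal.ofReal_lt_top⟩

theorem velGrad_memLp {L : ℝ} (u : V L) (q : Fin 3 × Fin 3) :
    MemLp (fun x => velGrad u x q) 2 (boxMeasure L) :=
  (EuclideanSpace.proj (𝕜 := ℝ) q).comp_memLp' (Lp.memLp _)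

/-- The function `((u · ∇) v) · w = ∑ᵢ ∑ⱼ uⱼ (∂ⱼ vᵢ) wᵢ` on `Ω`. -/
def advection {L : ℝ} (u v w : V L) (x : Pt) : ℝ :=
  ∑ i, ∑ j, vel u x j * velGrad v x (i, j) * vel w x i

theorem advection_integrable {L : ℝ} (u v w : V L) :
    Integrable (advection u v w) (boxMeasure L) :=
  integrable_finsetSum _ fun i _ => integrable_finsetSum _ fun j _ =>
    (triple_bound (vel_memLp u j) (velGrad_memLp v (i, j)) (vel_memLp w i)).1

theorem advection_bound {L : ℝ} (u v : V L) :
    ∃ C : ℝ, ∀ w : V L, ‖∫ x, advection u v w x ∂boxMeasure L‖ ≤ C * ‖w‖ := by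
  obtain ⟨C, hC, h⟩ := V_L4 L
  refine ⟨∑ i, ∑ j, (eLpNorm (fun x => vel u x j) 4 (boxMeasure L)).toReal *
    (eLpNorm (fun x => velGrad v x (i, j)) 2 (boxMeasure L)).toReal * C, fun w => ?_⟩
  have hb := fun i j =>
    triple_bound (vel_memLp u j) (velGrad_memLp v (i, j)) (vel_memLp w i)
  unfold advection
  rw [integral_finsetSum _ fun i _ => integrable_finsetSum _ fun j _ => (hb i j).1]
  simp_rw [integral_finsetSum _ fun j _ => (hb _ j).1]
  rw [Finset.sum_mul]
  refine (norm_sum_le _ _).trans (Finset.sum_le_sum fun i _ => ?_)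
  rw [Finset.sum_mul]
  refine (norm_sum_le _ _).trans (Finset.sum_le_sum fun j _ => ?_)
  refine (hb i j).2.trans ?_
  rw [mul_assoc _ C]
  refine mul_le_mul_of_nonneg_left ?_ (by positivity)
  exact ENNReal.toReal_le_of_le_ofReal (by positivity) (h w i)

/-- The bilinear operator `B : V × V → V'`, `B(u, v) = P_σ((u · ∇) v)`:
`⟨B(u, v), w⟩ = ∫_Ω ((u · ∇) v) · w` for `w ∈ V`. -/
def B {L : ℝ} (u v : V L) : V' L :=
  LinearMap.mkContinuousOfExistsBound
    { toFun := fun w => ∫ x, advection u v w x ∂boxMeasure L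
      map_add' := fun w z => by
        rw [← integral_add (advection_integrable u v w) (advection_integrable u v z)]
        refine integral_congr_ae ?_
        rw [Filter.EventuallyEq]
        have h := Lp.coeFn_add (vel w) (vel z)
        rw [← map_add] at h
        filter_upwards [h] with x hx
        simp only [advection, hx, Pi.add_apply, PiLp.add_apply, mul_add, Finset.sum_add_distrib]
      map_smul' := fun c w => by
        rw [RingHom.id_apply, smul_eq_mul, ← integral_const_mul]
        refine integral_congr_ae ?_
        have h := Lp.coeFn_smul c (vel w)
        rw [← map_smul] at h
        filter_upwards [h] with x hx
        simp only [advection, hx, Pi.smul_apply, PiLp.smul_apply, smul_eq_mul, Finset.mul_sum]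
        refine Finset.sum_congr rfl fun i _ => Finset.sum_congr rfl fun j _ => ?_
        ring }
    (advection_bound u v)

theorem B_apply {L : ℝ} (u v w : V L) : B u v w = ∫ x, advection u v w x ∂boxMeasure L := rfl

/-- The functions `u : ℝ → V` and `v : ℝ → V'` solve, for all times, the inviscid simplified
Bardina system `dv/dt + B(u, u) = f`, `v = u + α² A u`, `v(0) = v^in`, where the time derivative
is taken in the norm of the space in which `v` takes its values. -/
structure IsGlobalSolution {L : ℝ} (α : ℝ) (f vin : V' L) (u : ℝ → V L) (v : ℝ → V' L) :
    Prop where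
  relation : ∀ t, v t = incl (u t) + α ^ 2 • stokes (u t)
  equation : ∀ t, HasDerivAt v (f - B (u t) (u t)) t
  initial : v 0 = vin

end

end Bardina

/-! The operator `J = I + α²A : V → V'` is symmetric and coercive, hence an isomorphism by
Lax–Milgram (`exists_equiv_dual_of_coercive`). The system is therefore equivalent to `u' = J⁻¹f -
J⁻¹B(u,u)`, an ordinary differential equation in the Hilbert space `V`. The embedding of `V` into
`L⁴` makes `B` a bounded bilinear map (`norm_B_le`), so the right-hand side is continuous and
quadratic, and no loss of derivatives occurs. The same isomorphism carries `C¹` curves to `C¹`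
curves in both directions, which gives the equivalence between `u` and `v`.

A quadratic equation may blow up in finite time; the energy `⟨Ju,u⟩` excludes this. Since
`⟨B(u,u),u⟩ = 0` (`B_self_apply`), its derivative is `2⟨f,u⟩`, and coercivity with Grönwall's
inequality bounds it on every bounded interval, forwards and backwards in time.

Existence (`exists_global_quadratic_ode`) uses truncation instead of continuation of local
solutions. Composing the nonlinearity with the radial retraction onto a ball gives a bounded,
globally Lipschitz field, solvable on any prescribed interval. The retraction only rescales its
argument, so the energy cancellation persists, and with the radius taken from the energy bound the
truncation is never active. Uniqueness glues the solutions on growing intervals. -/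

namespace Bardina

/-! ### Global solutions of quadratic ODEs with a coercive energy. -/

section QuadraticODE

open Set

variable {X : Type*} [NormedAddCommGroup X] [NormedSpace ℝ X]

/-- The radial retraction onto the closed ball of radius `R`. -/
noncomputable def radial (R : ℝ) (x : X) : X := (R / max R ‖x‖) • x

theorem radial_of_norm_le {R : ℝ} (hR : 0 < R) {x : X} (hx : ‖x‖ ≤ R) : radial R x = x := by
  rw [radial, max_eq_left hx, div_self hR.ne', one_smul]

theorem norm_radial_le {R : ℝ} (hR : 0 < R) (x : X) : ‖radial R x‖ ≤ R := by
  have h : 0 < max R ‖x‖ := hR.trans_le (le_max_left _ _)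
  rw [radial, norm_smul, Real.norm_of_nonneg (by positivity), div_mul_eq_mul_div, div_le_iff₀ h]
  gcongr
  exact le_max_right _ _

/-- Moving the point with the scaling factor fixed costs `‖x - y‖`, and changing the factor costs as
much again. This gives the constant `2` in any normed space. -/
theorem norm_radial_sub_le {R : ℝ} (hR : 0 < R) (x y : X) :
    ‖radial R x - radial R y‖ ≤ 2 * ‖x - y‖ := by
  have hx : 0 < max R ‖x‖ := hR.trans_le (le_max_left _ _)
  have hy : 0 < max R ‖y‖ := hR.trans_le (le_max_left _ _)
  have e : radial R x - radial R y =
      (R / max R ‖x‖) • (x - y) + (R / max R ‖x‖ - R / max R ‖y‖) • y := by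
    rw [radial, radial, smul_sub, sub_smul]; abel
  have h1 : ‖(R / max R ‖x‖) • (x - y)‖ ≤ ‖x - y‖ := by
    rw [norm_smul, Real.norm_of_nonneg (by positivity)]
    exact mul_le_of_le_one_left (norm_nonneg _) ((div_le_one hx).2 (le_max_left _ _))
  have h2 : ‖(R / max R ‖x‖ - R / max R ‖y‖) • y‖ ≤ ‖x - y‖ := by
    -- The denominator `max R ‖y‖` is isolated because it absorbs the factor `‖y‖` of the vector.
    have e2 : R / max R ‖x‖ - R / max R ‖y‖ =
        (R / max R ‖x‖) * ((max R ‖y‖ - max R ‖x‖) / max R ‖y‖) := by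
      field_simp
    have h3 : |max R ‖y‖ - max R ‖x‖| ≤ ‖x - y‖ := by
      refine (abs_max_sub_max_le_max R ‖y‖ R ‖x‖).trans ?_
      rw [sub_self, abs_zero, max_eq_right (abs_nonneg _), norm_sub_rev]
      exact abs_norm_sub_norm_le y x
    rw [norm_smul, e2, norm_mul, Real.norm_of_nonneg (by positivity : 0 ≤ R / max R ‖x‖),
      norm_div, Real.norm_of_nonneg hy.le, Real.norm_eq_abs, mul_assoc]
    refine mul_le_of_le_one_left (by positivity) ((div_le_one hx).2 (le_max_left _ _)) |>.trans ?_
    rw [div_mul_eq_mul_div, div_le_iff₀ hy]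
    exact mul_le_mul h3 (le_max_right _ _) (norm_nonneg _) (norm_nonneg _)
  rw [e]
  linarith [norm_add_le ((R / max R ‖x‖) • (x - y)) ((R / max R ‖x‖ - R / max R ‖y‖) • y)]

/-- Bilinear splitting `Q(x,x) - Q(y,y) = Q(x,x-y) + Q(x-y,y)`: a quadratic map is Lipschitz on
balls, with constant proportional to the radius. -/
theorem norm_quadratic_sub_le (Q : X →L[ℝ] X →L[ℝ] X) {R : ℝ} {x y : X}
    (hx : ‖x‖ ≤ R) (hy : ‖y‖ ≤ R) : ‖Q x x - Q y y‖ ≤ 2 * ‖Q‖ * R * ‖x - y‖ := by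
  have e : Q x x - Q y y = Q x (x - y) + Q (x - y) y := by simp
  rw [e]
  have h1 : ‖Q x (x - y)‖ ≤ ‖Q‖ * R * ‖x - y‖ := (Q.le_opNorm₂ _ _).trans (by gcongr)
  have h2 : ‖Q (x - y) y‖ ≤ ‖Q‖ * R * ‖x - y‖ :=
    (Q.le_opNorm₂ _ _).trans (by rw [mul_right_comm]; gcongr)
  linarith [norm_add_le (Q x (x - y)) (Q (x - y) y)]

theorem lipschitzOnWith_quadratic (Q : X →L[ℝ] X →L[ℝ] X) (c : X) (R : ℝ) :
    LipschitzOnWith (2 * ‖Q‖ * R).toNNReal (fun x => c - Q x x) (Metric.closedBall 0 R) := by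
  refine LipschitzOnWith.of_dist_le' fun x hx y hy => ?_
  rw [mem_closedBall_zero_iff] at hx hy
  rw [dist_eq_norm, dist_eq_norm, sub_sub_sub_cancel_left, norm_sub_rev]
  exact norm_quadratic_sub_le Q hx hy

/-- Solutions of `x' = c - Q(x, x)` that agree at time `0` agree as long as they are bounded. -/
theorem eqOn_of_quadratic_ode (Q : X →L[ℝ] X →L[ℝ] X) (c : X) {T R : ℝ} (hT : 0 < T)
    {γ δ : ℝ → X} (hγ : ∀ t ∈ Ioo (-T) T, HasDerivAt γ (c - Q (γ t) (γ t)) t)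
    (hδ : ∀ t ∈ Ioo (-T) T, HasDerivAt δ (c - Q (δ t) (δ t)) t)
    (hγR : ∀ t ∈ Ioo (-T) T, ‖γ t‖ ≤ R) (hδR : ∀ t ∈ Ioo (-T) T, ‖δ t‖ ≤ R)
    (h0 : γ 0 = δ 0) : EqOn γ δ (Ioo (-T) T) :=
  ODE_solution_unique_of_mem_Ioo (v := fun _ x => c - Q x x) (s := fun _ => Metric.closedBall 0 R)
    (fun _ _ => lipschitzOnWith_quadratic Q c R) ⟨neg_lt_zero.2 hT, hT⟩
    (fun t ht => ⟨hγ t ht, mem_closedBall_zero_iff.2 (hγR t ht)⟩)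
    (fun t ht => ⟨hδ t ht, mem_closedBall_zero_iff.2 (hδR t ht)⟩) h0

/-- A global solution is continuous, hence bounded on each compact interval, so uniqueness among
bounded solutions applies near any given time. -/
theorem eq_of_quadratic_ode (Q : X →L[ℝ] X →L[ℝ] X) (c : X) {γ δ : ℝ → X}
    (hγ : ∀ t, HasDerivAt γ (c - Q (γ t) (γ t)) t) (hδ : ∀ t, HasDerivAt δ (c - Q (δ t) (δ t)) t)
    (h0 : γ 0 = δ 0) : γ = δ := by
  funext t
  have hT : 0 < |t| + 1 := by positivity
  have hbd : ∀ {η : ℝ → X}, (∀ t, HasDerivAt η (c - Q (η t) (η t)) t) →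
      ∃ R, ∀ s ∈ Icc (-(|t| + 1)) (|t| + 1), ‖η s‖ ≤ R := fun hη =>
    isCompact_Icc.exists_bound_of_continuousOn fun s _ => (hη s).continuousAt.continuousWithinAt
  obtain ⟨R₁, h1⟩ := hbd hγ
  obtain ⟨R₂, h2⟩ := hbd hδ
  exact eqOn_of_quadratic_ode Q c hT (fun s _ => hγ s) (fun s _ => hδ s)
    (fun s hs => (h1 s (Ioo_subset_Icc_self hs)).trans (le_max_left R₁ R₂))
    (fun s hs => (h2 s (Ioo_subset_Icc_self hs)).trans (le_max_right R₁ R₂)) h0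
    (abs_lt.1 (lt_add_one |t|))

/-- A bounded globally Lipschitz vector field has integral curves on bounded intervals. -/
theorem exists_hasDerivAt_of_lipschitz_of_bounded [CompleteSpace X] {G : X → X} {K : NNReal}
    {M T : ℝ} (hG : LipschitzWith K G) (hM : ∀ x, ‖G x‖ ≤ M) (hT : 0 < T) (x₀ : X) :
    ∃ γ : ℝ → X, γ 0 = x₀ ∧ ∀ t ∈ Ioo (-T) T, HasDerivAt γ (G (γ t)) t := by
  have hM0 : 0 ≤ M := (norm_nonneg _).trans (hM x₀)
  have h0 : (0 : ℝ) ∈ Icc (-T) T := ⟨by linarith, hT.le⟩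
  -- A curve of speed at most `M` stays within distance `M * T` of `x₀` up to time `T`. With a ball
  -- of that radius, Picard–Lindelöf imposes no smallness on `T`; the radius `0` means a single
  -- initial value.
  have hp : IsPicardLindelof (fun _ => G) (tmin := -T) (tmax := T) ⟨0, h0⟩ x₀
      (M * T).toNNReal 0 M.toNNReal K :=
    IsPicardLindelof.of_time_independent (fun x _ => (hM x).trans (Real.le_coe_toNNReal M))
      hG.lipschitzOnWith (by
        rw [Real.coe_toNNReal _ hM0, Real.coe_toNNReal _ (by positivity)]; simp)
  obtain ⟨γ, h1, h2⟩ := hp.exists_eq_forall_mem_Icc_hasDerivWithinAt₀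
  exact ⟨γ, h1, fun t ht => (h2 t (Ioo_subset_Icc_self ht)).hasDerivAt (Icc_mem_nhds ht.1 ht.2)⟩

/-- A scalar function with `|E'| ≤ K |E| + ε` grows at most exponentially in both directions. -/
theorem abs_le_gronwallBound {E E' : ℝ → ℝ} {K ε T : ℝ} (hK : 0 ≤ K) (hε : 0 ≤ ε)
    (hE : ∀ t ∈ Icc (-T) T, HasDerivAt E (E' t) t)
    (hb : ∀ t ∈ Icc (-T) T, |E' t| ≤ K * |E t| + ε) {t : ℝ} (ht : t ∈ Icc (-T) T) :
    |E t| ≤ gronwallBound |E 0| K ε T := by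
  -- The forward estimate is stated for an arbitrary function so that it also applies to `s ↦ E
  -- (-s)`, which covers negative times.
  have key : ∀ F F' : ℝ → ℝ, F 0 = E 0 → (∀ t ∈ Icc 0 T, HasDerivAt F (F' t) t) →
      (∀ t ∈ Icc 0 T, |F' t| ≤ K * |F t| + ε) → ∀ t ∈ Icc 0 T,
      |F t| ≤ gronwallBound |E 0| K ε T := by
    intro F F' h0 hF hFb t ht
    refine (norm_le_gronwallBound_of_norm_deriv_right_le (f := F) (f' := F')
      (fun s hs => (hF s hs).continuousAt.continuousWithinAt)
      (fun s hs => (hF s (Ico_subset_Icc_self hs)).hasDerivWithinAt)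
      (by rw [h0, Real.norm_eq_abs]) (fun s hs => hFb s (Ico_subset_Icc_self hs)) t ht).trans ?_
    exact gronwallBound_mono (abs_nonneg _) hε hK (by linarith [ht.2])
  rcases le_total 0 t with h | h
  · refine key E E' rfl (fun s hs => hE s ⟨by linarith [hs.1, hs.2], hs.2⟩)
      (fun s hs => hb s ⟨by linarith [hs.1, hs.2], hs.2⟩) t ⟨h, ht.2⟩
  · have hm : ∀ s ∈ Icc 0 T, -s ∈ Icc (-T) T := fun s hs => ⟨by linarith [hs.2], by
      linarith [hs.1, hs.2]⟩
    have := key (fun s => E (-s)) (fun s => -E' (-s)) (by simp)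
      (fun s hs => by
        simpa [Function.comp_def] using
          HasDerivAt.scomp s (hE (-s) (hm s hs)) (hasDerivAt_neg s))
      (fun s hs => by rw [abs_neg]; exact hb _ (hm s hs)) (-t) ⟨by linarith, by linarith [ht.1]⟩
    simpa using this

/-- Global solvability of `x' = c - Q(x, x)` when `Q` preserves a coercive quadratic form. -/
theorem exists_global_quadratic_ode [CompleteSpace X] (Q : X →L[ℝ] X →L[ℝ] X) (c : X)
    (S : X →L[ℝ] X →L[ℝ] ℝ) (hsymm : ∀ x y, S x y = S y x) {m : ℝ} (hm : 0 < m)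
    (hcoer : ∀ x, m * ‖x‖ ^ 2 ≤ S x x) (hQ : ∀ x, S (Q x x) x = 0) (x₀ : X) :
    ∃ γ : ℝ → X, γ 0 = x₀ ∧ ∀ t, HasDerivAt γ (c - Q (γ t) (γ t)) t := by
  have hloc : ∀ T : ℝ, 0 < T → ∃ R : ℝ, ∃ γ : ℝ → X, γ 0 = x₀ ∧ ∀ t ∈ Ioo (-T) T,
      ‖γ t‖ ≤ R ∧ HasDerivAt γ (c - Q (γ t) (γ t)) t := by
    intro T hT
    -- `D` is the a priori bound for the energy `S(γ,γ)` on `[-T, T]`, and by coercivity `√(m⁻¹ *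
    -- D)` bounds the norm. The added `1` makes `R` positive.
    set D : ℝ := gronwallBound |S x₀ x₀| m⁻¹ (‖S c‖ ^ 2) T with hD
    set R : ℝ := √(m⁻¹ * D) + 1 with hRdef
    have hR : 0 < R := by positivity
    -- The constant is `2‖Q‖R` on the ball times the Lipschitz constant `2` of the retraction.
    have hlip : LipschitzWith (4 * ‖Q‖ * R).toNNReal
        (fun x => c - Q (radial R x) (radial R x)) := by
      refine LipschitzWith.of_dist_le' fun x y => ?_
      rw [dist_eq_norm, dist_eq_norm, sub_sub_sub_cancel_left, norm_sub_rev]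
      refine (norm_quadratic_sub_le Q (norm_radial_le hR x) (norm_radial_le hR y)).trans ?_
      have := mul_le_mul_of_nonneg_left (norm_radial_sub_le hR x y)
        (by positivity : 0 ≤ 2 * ‖Q‖ * R)
      linarith
    have hbd : ∀ x, ‖c - Q (radial R x) (radial R x)‖ ≤ ‖c‖ + ‖Q‖ * R * R := fun x =>
      (norm_sub_le _ _).trans (add_le_add_right ((Q.le_opNorm₂ _ _).trans (by
        gcongr <;> exact norm_radial_le hR x)) _)
    -- Solving on the larger open interval gives two-sided derivatives on all of `[-T, T]`.
    obtain ⟨γ, h0, hγ⟩ := exists_hasDerivAt_of_lipschitz_of_bounded hlip hbd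
      (by linarith : 0 < T + 1) x₀
    have hγ' : ∀ t ∈ Icc (-T) T, HasDerivAt γ (c - Q (radial R (γ t)) (radial R (γ t))) t :=
      fun t ht => hγ t ⟨by linarith [ht.1], by linarith [ht.2]⟩
    have hE : ∀ t ∈ Icc (-T) T, HasDerivAt (fun t => S (γ t) (γ t)) (2 * S c (γ t)) t := by
      intro t ht
      have h1 := (S.hasFDerivAt.comp_hasDerivAt t (hγ' t ht)).clm_apply (hγ' t ht)
      convert! h1 using 1
      -- `radial R x` is a scalar multiple of `x`, so this term is the square of that scalar times
      -- `S(Q(x,x),x) = 0`: truncation preserves the energy law.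
      have hz : S (Q (radial R (γ t)) (radial R (γ t))) (γ t) = 0 := by
        simp only [radial, map_smul, smul_apply, hQ, smul_zero]
      rw [Function.comp_apply, hsymm (γ t), map_sub, sub_apply, hz]
      ring
    -- Young's inequality `2ab ≤ a² + b²`, with coercivity to replace `‖γ t‖²` by the energy.
    have hEb : ∀ t ∈ Icc (-T) T, |2 * S c (γ t)| ≤ m⁻¹ * |S (γ t) (γ t)| + ‖S c‖ ^ 2 := by
      intro t _
      have h1 : ‖γ t‖ ^ 2 ≤ m⁻¹ * |S (γ t) (γ t)| := by
        rw [inv_mul_eq_div, le_div_iff₀ hm, mul_comm]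
        exact (hcoer _).trans (le_abs_self _)
      have h2 := (S c).le_opNorm (γ t)
      rw [Real.norm_eq_abs] at h2
      rw [abs_mul, abs_two]
      nlinarith [sq_nonneg (‖S c‖ - ‖γ t‖)]
    have hγR : ∀ t ∈ Icc (-T) T, ‖γ t‖ ≤ R := by
      intro t ht
      have h1 := abs_le_gronwallBound (inv_nonneg.2 hm.le) (sq_nonneg ‖S c‖) hE hEb ht
      rw [h0, ← hD] at h1
      have h2 : ‖γ t‖ ^ 2 ≤ m⁻¹ * D := by
        rw [inv_mul_eq_div, le_div_iff₀ hm, mul_comm]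
        exact ((hcoer _).trans (le_abs_self _)).trans h1
      exact (Real.le_sqrt_of_sq_le h2).trans (by rw [hRdef]; linarith)
    -- The solution never leaves the ball on which the retraction is the identity, so it solves the
    -- original equation.
    refine ⟨R, γ, h0, fun t ht => ⟨hγR t (Ioo_subset_Icc_self ht), ?_⟩⟩
    have := hγ' t (Ioo_subset_Icc_self ht)
    rwa [radial_of_norm_le hR (hγR t (Ioo_subset_Icc_self ht))] at this
  choose! R γ h0 hγ using hloc
  have hagree : ∀ S T : ℝ, 0 < S → S ≤ T → EqOn (γ S) (γ T) (Ioo (-S) S) := by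
    intro S T hS hST
    have hT := hS.trans_le hST
    have hsub : ∀ t ∈ Ioo (-S) S, t ∈ Ioo (-T) T := fun t ht =>
      ⟨by linarith [ht.1], by linarith [ht.2]⟩
    exact eqOn_of_quadratic_ode Q c hS (fun t ht => (hγ S hS t ht).2)
      (fun t ht => (hγ T hT t (hsub t ht)).2)
      (fun t ht => (hγ S hS t ht).1.trans (le_max_left (R S) (R T)))
      (fun t ht => (hγ T hT t (hsub t ht)).1.trans (le_max_right (R S) (R T)))
      ((h0 S hS).trans (h0 T hT).symm)
  have hglob : ∀ T : ℝ, 0 < T → ∀ t ∈ Ioo (-T) T, γ (|t| + 1) t = γ T t := by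
    intro T hT t ht
    have h1 : 0 < |t| + 1 := by positivity
    rcases le_total (|t| + 1) T with h | h
    · exact hagree _ _ h1 h (abs_lt.1 (lt_add_one _))
    · exact (hagree _ _ hT h ht).symm
  -- At time `t` the solution on `(-(|t|+1), |t|+1)` is evaluated. Near `t` this agrees with one
  -- fixed solution, so the derivative is inherited.
  refine ⟨fun t => γ (|t| + 1) t, h0 _ (by simp), fun t => ?_⟩
  have hT : 0 < |t| + 1 := by positivity
  have htT : t ∈ Ioo (-(|t| + 1)) (|t| + 1) := abs_lt.1 (lt_add_one _)
  refine (hγ _ hT t htT).2.congr_of_eventuallyEq ?_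
  filter_upwards [Ioo_mem_nhds htT.1 htT.2] with s hs
  exact hglob _ hT s hs

end QuadraticODE

/-! ### Boundedness and energy cancellation of the advection term. -/

section Advection

variable {L : ℝ}

/-- The shift changes each phase by an integer multiple of `2π`. Periodicity serves to cancel
opposite faces of the box in the divergence theorem. -/
theorem trigPoly_add_period (hL : L ≠ 0) {φ : Pt → Vec} (h : φ ∈ trigPoly L) (j : Fin 3) (x : Pt) :
    φ (x + Pi.single j (2 * Real.pi * L)) = φ x := by
  have hp : ∀ k : Fin 3 → ℤ, phase L k (x + Pi.single j (2 * Real.pi * L)) =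
      phase L k x + k j * (2 * Real.pi) := by
    intro k
    simp only [phase, Pi.add_apply, mul_add, Finset.sum_add_distrib, add_div, Pi.single_apply,
      mul_ite, mul_zero, Finset.sum_ite_eq', Finset.mem_univ, if_true]
    field_simp
  induction h using Submodule.span_induction with
  | mem φ h =>
    obtain ⟨k, a, rfl | rfl⟩ := h
    · simp only [hp, Real.cos_add_int_mul_two_pi]
    · simp only [hp, Real.sin_add_int_mul_two_pi]
  | zero => rfl
  | add φ ψ _ _ h1 h2 => simp only [Pi.add_apply, h1, h2]
  | smul c φ _ h => simp only [Pi.smul_apply, h]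

/-- Divergence theorem for periodic fields: the boundary terms cancel. -/
theorem integral_sum_fderiv_eq_zero (hL : 0 ≤ L) {F : Fin 3 → Pt → ℝ}
    (hF : ∀ j, ContDiff ℝ 1 (F j))
    (hper : ∀ j x, F j (x + Pi.single j (2 * Real.pi * L)) = F j x) :
    ∫ x, ∑ j, fderiv ℝ (F j) x (Pi.single j 1) ∂boxMeasure L = 0 := by
  have hle : (0 : Pt) ≤ fun _ => 2 * Real.pi * L := fun _ => by
    simp only [Pi.zero_apply]; positivity
  have hc : Continuous fun x => ∑ j, fderiv ℝ (F j) x (Pi.single j 1) :=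
    continuous_finsetSum _ fun j _ => ((hF j).continuous_fderiv one_ne_zero).clm_apply continuous_const
  have := integral_divergence_of_hasFDerivAt_off_countable' (0 : Pt) (fun _ => 2 * Real.pi * L) hle
    F (fun j => fderiv ℝ (F j)) ∅ Set.countable_empty (fun j => (hF j).continuous.continuousOn)
    (fun x _ j => ((hF j).differentiable (by simp) x).hasFDerivAt)
    (hc.continuousOn.integrableOn_compact isCompact_Icc)
  rw [boxMeasure, box, this]
  refine Finset.sum_eq_zero fun j _ => ?_
  rw [sub_eq_zero]
  refine integral_congr_ae (Filter.Eventually.of_forall fun x => ?_)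
  simp only
  -- The value on the lower face is replaced by its translate by one period, which lies on the upper
  -- face.
  rw [← hper j (j.insertNth ((0 : Pt) j) x)]
  congr 1
  ext i
  refine Fin.succAboveCases j ?_ (fun i => ?_) i
  · simp
  · simp [Fin.succAbove_ne]

/-- The field `φ|φ|²` has divergence `2((φ·∇)φ)·φ + |φ|² div φ`. The last term vanishes, and the
integral of a periodic divergence is zero. -/
theorem integral_trilinear_solenoidal (hL : 0 < L) {φ : Pt → Vec} (hφ : φ ∈ solenoidal L) :
    ∫ x, ∑ i, ∑ j, φ x j * grad φ x (i, j) * φ x i ∂boxMeasure L = 0 := by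
  have hs := trigPoly_contDiff hφ.1
  have hd : ∀ i x, HasFDerivAt (fun y => φ y i)
      ((EuclideanSpace.proj (𝕜 := ℝ) i).comp (fderiv ℝ φ x)) x := fun i x =>
    (EuclideanSpace.proj (𝕜 := ℝ) i).hasFDerivAt.comp x (trigPoly_diff hφ.1 x).hasFDerivAt
  have hc : ∀ i, ContDiff ℝ 1 fun y => φ y i := fun i =>
    (EuclideanSpace.proj (𝕜 := ℝ) i).contDiff.comp (hs.of_le (by simp))
  have h0 := integral_sum_fderiv_eq_zero hL.le (F := fun j x => φ x j * ∑ i, φ x i ^ 2)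
    (fun j => (hc j).mul (ContDiff.sum fun i _ => (hc i).pow 2))
    (fun j x => by simp only [trigPoly_add_period hL.ne' hφ.1])
  have e : ∀ x, ∑ j, fderiv ℝ (fun x => φ x j * ∑ i, φ x i ^ 2) x (Pi.single j 1) =
      2 * ∑ i, ∑ j, φ x j * grad φ x (i, j) * φ x i := by
    intro x
    have hg : ∀ i j, fderiv ℝ φ x (Pi.single j 1) i = grad φ x (i, j) := fun _ _ => rfl
    have hj : ∀ j, fderiv ℝ (fun x => φ x j * ∑ i, φ x i ^ 2) x (Pi.single j 1) =
        φ x j * (∑ i, 2 * φ x i * grad φ x (i, j)) + (∑ i, φ x i ^ 2) * grad φ x (j, j) := by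
      intro j
      rw [((hd j x).fun_mul (HasFDerivAt.fun_sum fun i (_ : i ∈ Finset.univ) =>
        (hd i x).pow 2)).fderiv]
      simp [hg, mul_assoc]
    have hdiv := hφ.2.1 x
    rw [div] at hdiv
    simp only [hj]
    rw [Finset.sum_add_distrib, ← Finset.mul_sum, hdiv, mul_zero, add_zero]
    simp only [Finset.mul_sum]
    rw [Finset.sum_comm]
    exact Finset.sum_congr rfl fun i _ => Finset.sum_congr rfl fun j _ => by ring
  simp only [e, integral_const_mul] at h0
  simpa using h0

/-- Hölder with exponents `4, 2, 4` for each of the nine pairs `(i, j)`; each `L⁴` factor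
contributes one embedding constant `C`. Uniformity in all three arguments makes `B` continuous as a
bilinear map. -/
theorem advection_trilinear_bound (L : ℝ) : ∃ C : ℝ, ∀ u v w : V L,
    ‖∫ x, advection u v w x ∂boxMeasure L‖ ≤ C * ‖u‖ * ‖v‖ * ‖w‖ := by
  obtain ⟨C, hC, h⟩ := V_L4 L
  refine ⟨9 * C ^ 2, fun u v w => ?_⟩
  have h4 : ∀ (u : V L) i, (eLpNorm (fun x => vel u x i) 4 (boxMeasure L)).toReal ≤ C * ‖u‖ :=
    fun u i => ENNReal.toReal_le_of_le_ofReal (by positivity) (h u i)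
  have h2 : ∀ q, (eLpNorm (fun x => velGrad v x q) 2 (boxMeasure L)).toReal ≤ ‖v‖ := by
    intro q
    refine (ENNReal.toReal_mono (Lp.eLpNorm_ne_top (velGrad v))
      (eLpNorm_mono fun x => PiLp.norm_apply_le (velGrad v x) q)).trans ?_
    exact WithLp.norm_snd_le _ (v : L2Pair L)
  have hb := fun i j =>
    triple_bound (vel_memLp u j) (velGrad_memLp v (i, j)) (vel_memLp w i)
  have ht : ∀ i j, ‖∫ x, vel u x j * velGrad v x (i, j) * vel w x i ∂boxMeasure L‖ ≤
      C ^ 2 * ‖u‖ * ‖v‖ * ‖w‖ := fun i j =>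
    (hb i j).2.trans (calc
      _ ≤ C * ‖u‖ * ‖v‖ * (C * ‖w‖) := by
        gcongr
        exacts [h4 u j, h2 _, h4 w i]
      _ = _ := by ring)
  unfold advection
  rw [integral_finsetSum _ fun i _ => integrable_finsetSum _ fun j _ => (hb i j).1]
  simp_rw [integral_finsetSum _ fun j _ => (hb _ j).1]
  refine (norm_sum_le_of_le _ fun i _ => norm_sum_le_of_le _ fun j _ => ht i j).trans
    (le_of_eq ?_)
  simp only [Finset.sum_const, Finset.card_univ, Fintype.card_fin, nsmul_eq_mul]
  push_cast
  ring

theorem B_add_left (u u' v : V L) : B (u + u') v = B u v + B u' v := by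
  ext w
  rw [add_apply, B_apply, B_apply, B_apply,
    ← integral_add (advection_integrable u v w) (advection_integrable u' v w)]
  refine integral_congr_ae ?_
  have h := Lp.coeFn_add (vel u) (vel u')
  rw [← map_add] at h
  filter_upwards [h] with x hx
  simp only [advection, hx, Pi.add_apply, PiLp.add_apply, add_mul, Finset.sum_add_distrib]

theorem B_smul_left (c : ℝ) (u v : V L) : B (c • u) v = c • B u v := by
  ext w
  rw [smul_apply, B_apply, B_apply, smul_eq_mul, ← integral_const_mul]
  refine integral_congr_ae ?_
  have h := Lp.coeFn_smul c (vel u)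
  rw [← map_smul] at h
  filter_upwards [h] with x hx
  simp only [advection, hx, Pi.smul_apply, PiLp.smul_apply, smul_eq_mul, Finset.mul_sum, mul_assoc]

theorem B_add_right (u v v' : V L) : B u (v + v') = B u v + B u v' := by
  ext w
  rw [add_apply, B_apply, B_apply, B_apply,
    ← integral_add (advection_integrable u v w) (advection_integrable u v' w)]
  refine integral_congr_ae ?_
  have h := Lp.coeFn_add (velGrad v) (velGrad v')
  rw [← map_add] at h
  filter_upwards [h] with x hx
  simp only [advection, hx, Pi.add_apply, PiLp.add_apply, mul_add, add_mul,
    Finset.sum_add_distrib]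

theorem B_smul_right (c : ℝ) (u v : V L) : B u (c • v) = c • B u v := by
  ext w
  rw [smul_apply, B_apply, B_apply, smul_eq_mul, ← integral_const_mul]
  refine integral_congr_ae ?_
  have h := Lp.coeFn_smul c (velGrad v)
  rw [← map_smul] at h
  filter_upwards [h] with x hx
  simp only [advection, hx, Pi.smul_apply, PiLp.smul_apply, smul_eq_mul, Finset.mul_sum]
  exact Finset.sum_congr rfl fun i _ => Finset.sum_congr rfl fun j _ => by ring

theorem norm_B_le (L : ℝ) : ∃ C : ℝ, ∀ u v : V L, ‖B u v‖ ≤ C * ‖u‖ * ‖v‖ := by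
  obtain ⟨C, hC⟩ := advection_trilinear_bound L
  refine ⟨|C|, fun u v => ContinuousLinearMap.opNorm_le_bound _ (by positivity) fun w => ?_⟩
  rw [B_apply]
  refine (hC u v w).trans ?_
  gcongr
  exact le_abs_self C

/-- The operator `B` as a continuous bilinear map. -/
noncomputable def bilinB (L : ℝ) : V L →L[ℝ] V L →L[ℝ] V' L :=
  LinearMap.mkContinuous₂ (LinearMap.mk₂ ℝ B B_add_left B_smul_left B_add_right B_smul_right)
    (norm_B_le L).choose (norm_B_le L).choose_spec

theorem bilinB_apply (u v : V L) : bilinB L u v = B u v := rfl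

/-- The nonlinearity does no work: `⟨B(u, u), u⟩ = 0`. -/
theorem B_self_apply (hL : 0 < L) (u : V L) : B u u u = 0 := by
  have hcont : Continuous fun u : V L => bilinB L u u u :=
    (((bilinB L).continuous.clm_apply continuous_id).clm_apply continuous_id)
  have hclosed : IsClosed {u : V L | bilinB L u u u = 0} := isClosed_eq hcont continuous_const
  -- The identity is known for trigonometric fields only. It is a closed condition by continuity of
  -- `B`, so density of these fields in `V` extends it.
  have hdense : ∀ u : V L, u ∈ closure {u : V L | (u : L2Pair L) ∈ solenoidalH1 L} := by
    intro u
    rw [closure_subtype]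
    refine closure_mono ?_ u.2
    intro p hp
    exact ⟨⟨p, Submodule.le_topologicalClosure _ hp⟩, hp, rfl⟩
  refine closure_minimal ?_ hclosed (hdense u)
  rintro p ⟨φ, hφ, h1, h2⟩
  rw [Set.mem_ofPred_eq, bilinB_apply, B_apply, ← integral_trilinear_solenoidal hL hφ]
  refine integral_congr_ae ?_
  filter_upwards [h1, h2] with x hx1 hx2
  have e1 : vel p x = φ x := hx1
  have e2 : velGrad p x = grad φ x := hx2
  simp only [advection, e1, e2]

end Advection

/-! ### Reduction of the implicit equation to an ODE by Lax–Milgram. -/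

section Variational

variable {X : Type*} [NormedAddCommGroup X] [InnerProductSpace ℝ X] [CompleteSpace X]

/-- Lax–Milgram: a coercive form, viewed as an operator into the dual space, is an isomorphism. -/
theorem exists_equiv_dual_of_coercive {J : X →L[ℝ] StrongDual ℝ X} {m : ℝ} (hm : 0 < m)
    (hcoer : ∀ x, m * ‖x‖ ^ 2 ≤ J x x) : ∃ T : X ≃L[ℝ] StrongDual ℝ X, ∀ x, T x = J x := by
  have hc : IsCoercive J := ⟨m, hm, fun x => by rw [mul_assoc, ← sq]; exact hcoer x⟩
  refine ⟨hc.continuousLinearEquivOfBilin.trans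
    (InnerProductSpace.toDual ℝ X).toContinuousLinearEquiv, fun x => ?_⟩
  ext w
  exact hc.continuousLinearEquivOfBilin_apply x w

/-- The implicit evolution equation `d(Ju)/dt + N(u, u) = f`, with `J` symmetric and coercive and
`⟨N(u, u), u⟩ = 0`, is globally well posed. -/
theorem wellPosed_implicit_quadratic {J : X →L[ℝ] StrongDual ℝ X}
    (hsymm : ∀ x y, J x y = J y x) {m : ℝ} (hm : 0 < m) (hcoer : ∀ x, m * ‖x‖ ^ 2 ≤ J x x)
    (N : X →L[ℝ] X →L[ℝ] StrongDual ℝ X) (hN : ∀ x, N x x x = 0) (f v₀ : StrongDual ℝ X) :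
    (∃ u : ℝ → X, ContDiff ℝ 1 u ∧ J (u 0) = v₀ ∧
      ∀ t, HasDerivAt (fun t => J (u t)) (f - N (u t) (u t)) t) ∧
    (∀ u u' : ℝ → X, J (u 0) = v₀ → J (u' 0) = v₀ →
      (∀ t, HasDerivAt (fun t => J (u t)) (f - N (u t) (u t)) t) →
      (∀ t, HasDerivAt (fun t => J (u' t)) (f - N (u' t) (u' t)) t) → u = u') ∧
    ∀ u : ℝ → X, ContDiff ℝ 1 (fun t => J (u t)) ↔ ContDiff ℝ 1 u := by
  obtain ⟨T, hT⟩ := exists_equiv_dual_of_coercive hm hcoer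
  let Q : X →L[ℝ] X →L[ℝ] X :=
    (ContinuousLinearMap.compL ℝ X (StrongDual ℝ X) X (T.symm : StrongDual ℝ X →L[ℝ] X)).comp N
  have hQ : ∀ u w, Q u w = T.symm (N u w) := fun _ _ => rfl
  simp only [← hT]
  have hode : ∀ u : ℝ → X, (∀ t, HasDerivAt (fun t => T (u t)) (f - N (u t) (u t)) t) →
      ∀ t, HasDerivAt u (T.symm f - Q (u t) (u t)) t := by
    intro u h t
    have := T.symm.hasFDerivAt.comp_hasDerivAt t (h t)
    simpa [Function.comp_def, hQ] using this
  refine ⟨?_, fun u u' h0 h0' h h' => ?_, fun u => T.comp_contDiff_iff⟩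
  -- The form `J` itself is the energy: since `Q = J⁻¹N`, the work `J(Q(u,u))u` equals `N(u,u)u =
  -- 0`.
  · obtain ⟨u, hu0, hu⟩ := exists_global_quadratic_ode Q (T.symm f) J hsymm hm hcoer
      (fun u => by rw [hQ, ← hT, T.apply_symm_apply, hN]) (T.symm v₀)
    refine ⟨u, ?_, by simp [hu0], fun t => ?_⟩
    · have hd : Differentiable ℝ u := fun t => (hu t).differentiableAt
      -- The derivative equals the right-hand side of the equation, which is continuous along a
      -- continuous curve.
      refine contDiff_one_iff_deriv.2 ⟨hd, ?_⟩
      rw [show deriv u = fun t => T.symm f - Q (u t) (u t) from funext fun t => (hu t).deriv]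
      exact continuous_const.sub ((Q.continuous.comp hd.continuous).clm_apply hd.continuous)
    · have := T.hasFDerivAt.comp_hasDerivAt t (hu t)
      simpa [Function.comp_def, hQ] using this
  · exact eq_of_quadratic_ode Q _ (hode u h) (hode u' h')
      (T.injective (h0.trans h0'.symm))

end Variational

/-! ### The operator `I + α²A` as a symmetric coercive form. -/

section Helmholtz

variable {L : ℝ}

instance : CompleteSpace (V L) :=
  inferInstanceAs (CompleteSpace (solenoidalH1 L).topologicalClosure)

/-- The operator `I + α² A : V → V'`. -/
noncomputable def helmholtz (L α : ℝ) : V L →L[ℝ] V' L := incl + α ^ 2 • stokes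

theorem helmholtz_apply_apply (α : ℝ) (u w : V L) :
    helmholtz L α u w = inner ℝ (vel u) (vel w) + α ^ 2 * inner ℝ (velGrad u) (velGrad w) := rfl

theorem helmholtz_symm (α : ℝ) (u w : V L) : helmholtz L α u w = helmholtz L α w u := by
  rw [helmholtz_apply_apply, helmholtz_apply_apply, real_inner_comm (vel w),
    real_inner_comm (velGrad w)]

/-- The norm of `V` is the full `H¹` norm, whose square splits into velocity and gradient parts.
Comparing weights `1` and `α²` suffices, without a Poincaré inequality. -/
theorem helmholtz_coercive (α : ℝ) (u : V L) :
    min 1 (α ^ 2) * ‖u‖ ^ 2 ≤ helmholtz L α u u := by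
  have h : ‖u‖ ^ 2 = ‖vel u‖ ^ 2 + ‖velGrad u‖ ^ 2 := WithLp.prod_norm_sq_eq_of_L2 (u : L2Pair L)
  rw [helmholtz_apply_apply, real_inner_self_eq_norm_sq, real_inner_self_eq_norm_sq, h, mul_add]
  gcongr
  · exact mul_le_of_le_one_left (sq_nonneg _) (min_le_left _ _)
  · exact min_le_right _ _

end Helmholtz

end Bardina

/-! ### Well-posedness of the Bardina system. -/

theorem mainTheorem3 (L α : ℝ) (hL : 0 < L) (hα : 0 < α) (f vin : Bardina.V' L) :
    (∃! v : ℝ → Bardina.V' L, ContDiff ℝ 1 v ∧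
      ∃ u : ℝ → Bardina.V L, Bardina.IsGlobalSolution α f vin u v) ∧
    (∃! u : ℝ → Bardina.V L, ContDiff ℝ 1 u ∧
      ∃ v : ℝ → Bardina.V' L, Bardina.IsGlobalSolution α f vin u v) ∧
    (∀ (u : ℝ → Bardina.V L) (v : ℝ → Bardina.V' L),
      (∀ t, v t = Bardina.incl (u t) + α ^ 2 • Bardina.stokes (u t)) →
        (ContDiff ℝ 1 v ↔ ContDiff ℝ 1 u)) := by
  obtain ⟨⟨u, hu1, hu0, hu⟩, huniq, hreg⟩ := Bardina.wellPosed_implicit_quadratic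
    (Bardina.helmholtz_symm (L := L) α) (by positivity : 0 < min 1 (α ^ 2))
    (Bardina.helmholtz_coercive α) (Bardina.bilinB L) (Bardina.B_self_apply hL) f vin
  have hrel : ∀ (u : ℝ → Bardina.V L) (v : ℝ → Bardina.V' L),
      (∀ t, v t = Bardina.incl (u t) + α ^ 2 • Bardina.stokes (u t)) →
        v = fun t => Bardina.helmholtz L α (u t) := fun u v h => funext h
  have hsol : Bardina.IsGlobalSolution α f vin u fun t => Bardina.helmholtz L α (u t) :=
    ⟨fun _ => rfl, hu, hu0⟩
  -- Since `v` is a function of `u`, uniqueness of `u` settles both uniqueness claims.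
  have hunique : ∀ u' v', Bardina.IsGlobalSolution α f vin u' v' → u' = u := by
    intro u' v' h
    obtain rfl := hrel u' v' h.relation
    exact huniq u' u h.initial hu0 h.equation hu
  refine ⟨⟨_, ⟨(hreg u).2 hu1, u, hsol⟩, ?_⟩, ⟨u, ⟨hu1, _, hsol⟩, ?_⟩, fun u v h => ?_⟩
  · rintro v ⟨-, u', h⟩
    rw [hrel u' v h.relation, hunique u' v h]
  · rintro u' ⟨-, v, h⟩
    exact hunique u' v h
  · rw [hrel u v h]
    exact hreg u
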